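/- Consider the following algorithm for maintaining a topological order of a directed acyclic graph on a finite set $V$ of $n$ vertices under edge insertions. The current order is a bijection $T:V\to\{1,\dots,n\}$; write $u<v$ for $T(u)<T(v)$, $u\to v$ if $(u,v)$ is a current edge, and $d(u,v)=|T(v)-T(u)|$. Fix an integer $p\ge 0$ and real thresholds $\sqrt n<t_0<t_1<\dots<t_p<t_{p+1}=n$. $\textsc{Insert}(u,v)$: if $v\le u$, call $\textsc{Reorder}(v,u,0,0)$; then add the edge $(u,v)$ to the graph. $\textsc{Reorder}(u,v,f_1,f_2)$: if $v\le u$, exit. Otherwise put $\hat A_i=\{w: u\to w,\ d(u,w)\le t_i,\ w<v\}$ and $\hat B_i=\{w: w\to v,\ d(w,v)\le t_i,\ w>u\}$. If $t_i<d(u,v)\le t_{i+1}$ for some $0\le i\le p$, let $A=\hat A_i$ if $\hat A_i\ne\emptyset$ or $f_1=1$, and $A=\hat A_{i+1}$ otherwise, and let $B=\hat B_i$ if $\hat B_i\neq\emptyset$ or $f_2=1$, and $B=\hat B_{i+1}$ otherwise. If $d(u,v)\le t_0$, let $A=\hat A_0$ and $B=\hat B_0$. If $A=B=\emptyset$, swap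 the positions of $u$ and $v$ in $T$ and exit. Otherwise, for each $u'\in\{u\}\cup A$ in decreasing order, and for each $v'\in B\cup\{v\}$ with $v'>u'$ in increasing order (all with respect to the order $T$ at the start of this call), call $\textsc{Reorder}(u',v',f_1',f_2')$, where $f_1'=1$ if and only if $u'=u$ and $A=\emptyset$, and $f_2'=1$ if and only if $v'=v$ and $B=\emptyset$. Start from any directed acyclic graph on $V$ with any topological order $T$ of it, and insert any finite sequence of edges, one after the other, such that the graph stays acyclic. Then the algorithm terminates and every unordered pair of vertices is swapped at most once. For an ordered pair $(u,v)$ of vertices let $D(u,v)$ be the value of $d(u,v)$ at the moment at which $u$ and $v$ are swapped, if they are swapped at a moment when $u<v$, and $D(u,v)=0$ otherwise; let $D_k(u,v)=\min(D(u,v),k)$. **Theorem.** There is an absolute constant $C>0$ (independent of $n$, $p$, the thresholds, the starting graph and order, the inserted edges, and $k$) such that for every real $k$ with $\sqrt n\le k\le n$, $$\sum_{u,v\in V} D_k(u,v)\le C\,n^2\sqrt k .$$ -/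

import Mathlib

namespace OnlineTopo

universe u

variable {V : Type u} [Fintype V] [DecidableEq V]

/-- A linear order of the vertices, as a bijection onto the `n = |V|` positions
(numbered from `0`; only comparisons and differences of positions are ever used). -/
abbrev Order (V : Type u) [Fintype V] : Type u := V ≃ Fin (Fintype.card V)

/-- The directed graph with edge set `E` is acyclic: no vertex reaches itself by a nonempty path. -/
def Acyclic (E : Finset (V × V)) : Prop :=
  ∀ x : V, ¬ Relation.TransGen (fun a b => (a, b) ∈ E) x x

/-- `T` is a topological order of the directed graph with edge set `E`. -/
def IsTopologicalOrder (E : Finset (V × V)) (T : Order V) : Prop :=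
  ∀ a b : V, (a, b) ∈ E → T a < T b

/-- The distance `d(a,b) = |T(b) - T(a)|`. -/
def dist (T : Order V) (a b : V) : ℕ :=
  (((T b : ℕ) : ℤ) - ((T a : ℕ) : ℤ)).natAbs

open Classical in
/-- `{w : u → w, d(u,w) ≤ r, w < v}`. -/
noncomputable def outNear (E : Finset (V × V)) (T : Order V) (u v : V) (r : ℝ) : Finset V :=
  Finset.univ.filter fun w => (u, w) ∈ E ∧ (dist T u w : ℝ) ≤ r ∧ T w < T v

open Classical in
/-- `{w : w → v, d(w,v) ≤ r, w > u}`. -/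
noncomputable def inNear (E : Finset (V × V)) (T : Order V) (u v : V) (r : ℝ) : Finset V :=
  Finset.univ.filter fun w => (w, v) ∈ E ∧ (dist T w v : ℝ) ≤ r ∧ T u < T w

open Classical in
/-- The set `A` computed by the call `Reorder(u,v,f₁,f₂)`, for thresholds `t₀ < ⋯ < t_{p+1}`.
If `t_i < d(u,v) ≤ t_{i+1}` (the index `i` is unique as `t` is strictly increasing), then the
set with radius `t_i` is taken if it is nonempty or `f₁ = 1`, and the one with radius `t_{i+1}`
otherwise; if there is no such `i`, the set with radius `t₀` is taken. -/
noncomputable def setA {p : ℕ} (t : Fin (p + 2) → ℝ) (E : Finset (V × V)) (T : Order V)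
    (u v : V) (f₁ : Bool) : Finset V :=
  if h : ∃ i : Fin (p + 1), t i.castSucc < dist T u v ∧ (dist T u v : ℝ) ≤ t i.succ then
    if (outNear E T u v (t h.choose.castSucc)).Nonempty ∨ f₁ = true then
      outNear E T u v (t h.choose.castSucc)
    else outNear E T u v (t h.choose.succ)
  else outNear E T u v (t 0)

open Classical in
/-- The set `B` computed by the call `Reorder(u,v,f₁,f₂)`, symmetric to `setA`. -/
noncomputable def setB {p : ℕ} (t : Fin (p + 2) → ℝ) (E : Finset (V × V)) (T : Order V)
    (u v : V) (f₂ : Bool) : Finset V :=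
  if h : ∃ i : Fin (p + 1), t i.castSucc < dist T u v ∧ (dist T u v : ℝ) ≤ t i.succ then
    if (inNear E T u v (t h.choose.castSucc)).Nonempty ∨ f₂ = true then
      inNear E T u v (t h.choose.castSucc)
    else inNear E T u v (t h.choose.succ)
  else inNear E T u v (t 0)

/-- The elements of `S`, listed by increasing position. -/
def increasing (T : Order V) (S : Finset V) : List V :=
  ((S.image T).sort (fun a b => a ≤ b)).map T.symm

/-- The elements of `S`, listed by decreasing position. -/
def decreasing (T : Order V) (S : Finset V) : List V :=
  (increasing T S).reverse

/-- The instructions on the control stack of the algorithm. -/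
inductive Instr (V : Type u) : Type u
  /-- The call `Insert(u,v)`. -/
  | insertEdge (u v : V)
  /-- Add the edge `(u,v)` to the graph (the second line of `Insert`). -/
  | addEdge (u v : V)
  /-- The call `Reorder(u,v,f₁,f₂)`. -/
  | reorder (u v : V) (f₁ f₂ : Bool)

/-- The recursive calls made by the two nested loops of `Reorder(u,v,·,·)`: the outer loop runs
over `u' ∈ {u} ∪ A` by decreasing position, the inner loop over the `v' ∈ B ∪ {v}` with `v' > u'`
by increasing position, where positions are those at the start of the call. -/
def subcalls (T : Order V) (u v : V) (A B : Finset V) : List (Instr V) :=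
  (decreasing T (insert u A)).flatMap fun u' =>
    (increasing T ((insert v B).filter fun v' => T u' < T v')).map fun v' =>
      Instr.reorder u' v' (decide (u' = u ∧ A = ∅)) (decide (v' = v ∧ B = ∅))

/-- A state of the execution: the current graph, the current order, the control stack, and the
log of all swaps made so far. A swap of `u` and `v` made by `Reorder(u,v,·,·)` at a moment when
`u < v` is logged as `((u, v), d(u,v))`, with `d(u,v)` measured right before the swap. -/
structure State (V : Type u) [Fintype V] : Type u where
  E : Finset (V × V)
  T : Order V
  todo : List (Instr V)
  swaps : List ((V × V) × ℕ)

/-- One step of the execution: carry out the instruction on top of the control stack. -/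
noncomputable def step {p : ℕ} (t : Fin (p + 2) → ℝ) (s : State V) : State V :=
  match s.todo with
  | [] => s
  | Instr.insertEdge u v :: rest =>
      if s.T v ≤ s.T u then
        { s with todo := Instr.reorder v u false false :: Instr.addEdge u v :: rest }
      else { s with todo := Instr.addEdge u v :: rest }
  | Instr.addEdge u v :: rest => { s with E := insert (u, v) s.E, todo := rest }
  | Instr.reorder u v f₁ f₂ :: rest =>
      if s.T v ≤ s.T u then { s with todo := rest }
      else if setA t s.E s.T u v f₁ = ∅ ∧ setB t s.E s.T u v f₂ = ∅ then
        { s with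
          T := (Equiv.swap u v).trans s.T
          todo := rest
          swaps := s.swaps ++ [((u, v), dist s.T u v)] }
      else
        { s with
          todo := subcalls s.T u v (setA t s.E s.T u v f₁) (setB t s.E s.T u v f₂) ++ rest }

/-- The initial state for inserting the edges in the list `es`, one after the other, into the
graph `E₀` with order `T₀`. -/
def start (E₀ : Finset (V × V)) (T₀ : Order V) (es : List (V × V)) : State V where
  E := E₀
  T := T₀
  todo := es.map fun e => Instr.insertEdge e.1 e.2
  swaps := []

/-- The execution from `s₀` terminates in the state `s`. The execution is deterministic and stays
put once the control stack is empty, so there is at most one such `s`. -/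
def HaltsIn {p : ℕ} (t : Fin (p + 2) → ℝ) (s₀ s : State V) : Prop :=
  ∃ N : ℕ, (step t)^[N] s₀ = s ∧ s.todo = []

/-- No two entries of the log concern the same unordered pair of vertices. -/
def EachPairSwappedAtMostOnce (L : List ((V × V) × ℕ)) : Prop :=
  (L.map fun e => s(e.1.1, e.1.2)).Nodup

/-- `D(u,v)`: the value of `d(u,v)` at the swap of `u` and `v` with `u < v`, and `0` if there is
no such swap. -/
def D (L : List ((V × V) × ℕ)) (u v : V) : ℕ :=
  (L.lookup (u, v)).getD 0

/-- `D_k(u,v)`: the value `D(u,v)` if it is at most `k`, and `k` otherwise. -/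
noncomputable def Dk (L : List ((V × V) × ℕ)) (k : ℝ) (u v : V) : ℝ :=
  open Classical in if (D L u v : ℝ) ≤ k then (D L u v : ℝ) else k

end OnlineTopo

/-!
While the edge `(x, y)` is being inserted, every call `Reorder(u,v,·,·)` has `u` reachable from `y`
and `v` leading to `x`. As the new edge creates no cycle, no vertex is of both kinds, so a swap with
`u < v` moves descendants of `y` up and ancestors of `x` down; the two swapped vertices stay
inverted, and once `(x, y)` has been added a path from `v` to `u` keeps them so for good. Hence
every pair is swapped at most once. Until the next swap the order is fixed and the gap of the
topmost active call shrinks with each expansion, so the algorithm terminates.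

A swap of `u` and `v` at distance `d` raises `u` by `d` and lowers `v` by `d`. With `T₀` and `T` the
first and the last order, summing the displacements with weights `T(w)` gives
`∑ d (T(u) - T(v)) = ∑_w T(w) (T(w) - T₀(w)) ≤ n³`, and the terms on the left are positive because
`u` and `v` end up inverted. Pairs at final distance at most `n / √k` number at most `n · n / √k`
and contribute at most `k` each; for the others `D ≤ D (T(u) - T(v)) √k / n`. Either part is at
most `n² √k`.
-/

namespace OnlineTopo

open Relation

universe u

section Thresholds

theorem exists_castSucc_lt_le_succ {α : Type*} [LinearOrder α] {n : ℕ} {t : Fin (n + 1) → α}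
    {x : α} (h₀ : t 0 < x) (hx : x ≤ t (Fin.last n)) :
    ∃ i : Fin n, t i.castSucc < x ∧ x ≤ t i.succ := by
  by_contra! h
  exact hx.not_gt (Fin.induction (motive := fun i => t i < x) h₀ h (Fin.last n))

open Classical in
/-- The common selection rule of `setA` and `setB`: from a family of sets indexed by radii, take
the one at the threshold just below `d` if it is nonempty or `f` is set, and the one at the
threshold just above `d` otherwise. -/
noncomputable def thresholdSelect {α : Type*} {p : ℕ} (t : Fin (p + 2) → ℝ) (d : ℝ)
    (F : ℝ → Finset α) (f : Bool) : Finset α :=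
  if h : ∃ i : Fin (p + 1), t i.castSucc < d ∧ d ≤ t i.succ then
    if (F (t h.choose.castSucc)).Nonempty ∨ f = true then F (t h.choose.castSucc)
    else F (t h.choose.succ)
  else F (t 0)

variable {α : Type*} {p : ℕ} {t : Fin (p + 2) → ℝ} {d : ℝ} {F : ℝ → Finset α} {f : Bool}

theorem exists_eq_of_thresholdSelect (t : Fin (p + 2) → ℝ) (d : ℝ) (F : ℝ → Finset α) (f : Bool) :
    ∃ r, thresholdSelect t d F f = F r := by
  unfold thresholdSelect
  split_ifs <;> exact ⟨_, rfl⟩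

theorem eq_empty_of_thresholdSelect_eq_empty (hF : Monotone F) (hd : d ≤ t (Fin.last (p + 1)))
    (hf : f = true → F d = ∅) (h : thresholdSelect t d F f = ∅) : F d = ∅ := by
  have of_le {r : ℝ} (hr : d ≤ r) (hFr : F r = ∅) : F d = ∅ :=
    Finset.subset_empty.1 (hFr ▸ hF hr)
  unfold thresholdSelect at h
  split_ifs at h with hex hlow
  · exact hlow.elim (fun hne => absurd h hne.ne_empty) hf
  · exact of_le hex.choose_spec.2 h
  · exact of_le (not_lt.1 fun h₀ => hex (exists_castSucc_lt_le_succ h₀ hd)) h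

end Thresholds

section Orders

/-- The adjacency relation of the directed graph with edge set `E`. -/
abbrev Edge {V : Type u} (E : Finset (V × V)) (a b : V) : Prop := (a, b) ∈ E

variable {V : Type u} [Fintype V] {T : Order V} {E : Finset (V × V)} {u v : V}

theorem cast_dist (T : Order V) (a b : V) :
    (dist T a b : ℝ) = |((T b : ℕ) : ℝ) - ((T a : ℕ) : ℝ)| := by
  simp [dist, Nat.cast_natAbs]

theorem cast_dist_of_lt {a b : V} (h : T a < T b) :
    (dist T a b : ℝ) = ((T b : ℕ) : ℝ) - ((T a : ℕ) : ℝ) := by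
  rw [cast_dist, abs_of_pos (sub_pos.2 (Nat.cast_lt.2 h))]

theorem dist_le_card (T : Order V) (a b : V) : dist T a b ≤ Fintype.card V := by
  have := (T a).isLt
  have := (T b).isLt
  unfold dist
  omega

theorem card_filter_lt_and_dist_le (T : Order V) (u : V) (m : ℕ) :
    (Finset.univ.filter fun v => T v < T u ∧ dist T v u ≤ m).card ≤ m := by
  suffices (Finset.univ.filter fun v => T v < T u ∧ dist T v u ≤ m).card ≤ (Finset.Icc 1 m).card by
    simpa using this
  refine Finset.card_le_card_of_injOn (fun v => dist T v u) (fun v hv => ?_) fun v hv w hw h => ?_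
  · simp only [Finset.coe_filter, Finset.mem_univ, true_and, Set.mem_ofPred_eq, Fin.lt_def] at hv
    refine Finset.mem_coe.2 (Finset.mem_Icc.2 ⟨?_, hv.2⟩)
    simp only [dist]
    omega
  · simp only [Finset.coe_filter, Finset.mem_univ, true_and, Set.mem_ofPred_eq, Fin.lt_def] at hv hw
    simp only [dist] at h
    exact T.injective (Fin.ext (by omega))

theorem IsTopologicalOrder.lt_of_transGen (hT : IsTopologicalOrder E T)
    (h : TransGen (Edge E) u v) : T u < T v := by
  induction h with
  | single h => exact hT _ _ h
  | tail _ h ih => exact ih.trans (hT _ _ h)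

/-- No out-neighbour of `u` lies before `v`: this is what `f₁ = 1` asserts in a call
`Reorder(u,v,f₁,f₂)`. -/
def NoOutBefore (E : Finset (V × V)) (T : Order V) (u v : V) : Prop :=
  ∀ w, (u, w) ∈ E → T v ≤ T w

/-- No in-neighbour of `v` lies after `u`: this is what `f₂ = 1` asserts in a call
`Reorder(u,v,f₁,f₂)`. -/
def NoInAfter (E : Finset (V × V)) (T : Order V) (u v : V) : Prop :=
  ∀ w, (w, v) ∈ E → T w ≤ T u

end Orders

section NearSets

variable {V : Type u} [Fintype V] [DecidableEq V] {T : Order V} {E : Finset (V × V)} {u v w : V}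
  {r : ℝ} {p : ℕ} {t : Fin (p + 2) → ℝ} {f : Bool}

theorem mem_outNear : w ∈ outNear E T u v r ↔ (u, w) ∈ E ∧ (dist T u w : ℝ) ≤ r ∧ T w < T v := by
  simp [outNear]

theorem mem_inNear : w ∈ inNear E T u v r ↔ (w, v) ∈ E ∧ (dist T w v : ℝ) ≤ r ∧ T u < T w := by
  simp [inNear]

theorem monotone_outNear : Monotone (outNear E T u v) := fun _ _ hrs _ hw => by
  rw [mem_outNear] at hw ⊢
  exact ⟨hw.1, hw.2.1.trans hrs, hw.2.2⟩

theorem monotone_inNear : Monotone (inNear E T u v) := fun _ _ hrs _ hw => by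
  rw [mem_inNear] at hw ⊢
  exact ⟨hw.1, hw.2.1.trans hrs, hw.2.2⟩

theorem outNear_dist_eq_empty_iff (hT : IsTopologicalOrder E T) :
    outNear E T u v (dist T u v) = ∅ ↔ NoOutBefore E T u v := by
  simp only [Finset.eq_empty_iff_forall_notMem, mem_outNear, NoOutBefore, not_and, not_lt,
    Nat.cast_le]
  refine forall₂_congr fun w hw => ⟨fun h => ?_, fun h _ => h⟩
  by_contra! hwv
  have huw := hT u w hw
  refine hwv.not_ge (h ?_)
  simp only [dist, Fin.lt_def] at *
  omega

theorem inNear_dist_eq_empty_iff (hT : IsTopologicalOrder E T) :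
    inNear E T u v (dist T u v) = ∅ ↔ NoInAfter E T u v := by
  simp only [Finset.eq_empty_iff_forall_notMem, mem_inNear, NoInAfter, not_and, not_lt,
    Nat.cast_le]
  refine forall₂_congr fun w hw => ⟨fun h => ?_, fun h _ => h⟩
  by_contra! huw
  have hwv := hT w v hw
  refine huw.not_ge (h ?_)
  simp only [dist, Fin.lt_def] at *
  omega

theorem setA_eq_thresholdSelect (t : Fin (p + 2) → ℝ) (E : Finset (V × V)) (T : Order V) (u v : V)
    (f : Bool) : setA t E T u v f = thresholdSelect t (dist T u v) (outNear E T u v) f :=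
  rfl

theorem setB_eq_thresholdSelect (t : Fin (p + 2) → ℝ) (E : Finset (V × V)) (T : Order V) (u v : V)
    (f : Bool) : setB t E T u v f = thresholdSelect t (dist T u v) (inNear E T u v) f :=
  rfl

theorem edge_and_lt_of_mem_setA (hw : w ∈ setA t E T u v f) : (u, w) ∈ E ∧ T w < T v := by
  obtain ⟨r, hr⟩ := exists_eq_of_thresholdSelect t (dist T u v) (outNear E T u v) f
  rw [setA_eq_thresholdSelect, hr, mem_outNear] at hw
  exact ⟨hw.1, hw.2.2⟩

theorem edge_and_lt_of_mem_setB (hw : w ∈ setB t E T u v f) : (w, v) ∈ E ∧ T u < T w := by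
  obtain ⟨r, hr⟩ := exists_eq_of_thresholdSelect t (dist T u v) (inNear E T u v) f
  rw [setB_eq_thresholdSelect, hr, mem_inNear] at hw
  exact ⟨hw.1, hw.2.2⟩

theorem noOutBefore_of_setA_eq_empty (ht : (Fintype.card V : ℝ) ≤ t (Fin.last (p + 1)))
    (hT : IsTopologicalOrder E T) (hf : f = true → NoOutBefore E T u v)
    (h : setA t E T u v f = ∅) : NoOutBefore E T u v := by
  simp only [← outNear_dist_eq_empty_iff hT] at hf ⊢
  exact eq_empty_of_thresholdSelect_eq_empty monotone_outNear
    ((Nat.cast_le.2 (dist_le_card T u v)).trans ht) hf h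

theorem noInAfter_of_setB_eq_empty (ht : (Fintype.card V : ℝ) ≤ t (Fin.last (p + 1)))
    (hT : IsTopologicalOrder E T) (hf : f = true → NoInAfter E T u v)
    (h : setB t E T u v f = ∅) : NoInAfter E T u v := by
  simp only [← inNear_dist_eq_empty_iff hT] at hf ⊢
  exact eq_empty_of_thresholdSelect_eq_empty monotone_inNear
    ((Nat.cast_le.2 (dist_le_card T u v)).trans ht) hf h

end NearSets

section Swaps

variable {V : Type u} [Fintype V] [DecidableEq V] {T T₀ : Order V} {E : Finset (V × V)}
  {L : List ((V × V) × ℕ)} {u v w : V}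

theorem le_swap_trans_apply (huv : T u < T v) (hw : w ≠ v) : T w ≤ (Equiv.swap u v).trans T w := by
  rcases eq_or_ne w u with rfl | hwu
  · simpa using huv.le
  · simp [Equiv.swap_apply_of_ne_of_ne hwu hw]

theorem swap_trans_apply_le (huv : T u < T v) (hw : w ≠ u) : (Equiv.swap u v).trans T w ≤ T w := by
  rcases eq_or_ne w v with rfl | hwv
  · simpa using huv.le
  · simp [Equiv.swap_apply_of_ne_of_ne hw hwv]

theorem IsTopologicalOrder.swap_trans (hT : IsTopologicalOrder E T) (huv : T u < T v)
    (hE : (u, v) ∉ E) (hu : NoOutBefore E T u v) (hv : NoInAfter E T u v) :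
    IsTopologicalOrder E ((Equiv.swap u v).trans T) := by
  intro a b hab
  rcases eq_or_ne a u with rfl | hau
  · have hbv : b ≠ v := fun h => hE (h ▸ hab)
    calc (Equiv.swap a v).trans T a = T v := by simp
      _ < T b := (hu b hab).lt_of_ne (T.injective.ne hbv.symm)
      _ ≤ (Equiv.swap a v).trans T b := le_swap_trans_apply huv hbv
  rcases eq_or_ne b v with rfl | hbv
  · calc (Equiv.swap u b).trans T a ≤ T a := swap_trans_apply_le huv hau
      _ < T u := (hv a hab).lt_of_ne (T.injective.ne hau)
      _ = (Equiv.swap u b).trans T b := by simp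
  exact (swap_trans_apply_le huv hau).trans_lt
    ((hT a b hab).trans_le (le_swap_trans_apply huv hbv))

/-- `L` logs, with distances, a sequence of swaps that leads from the order `T₀` to the order `T`,
where each entry `((u, v), d)` is made at a moment when `u` lies before `v`. -/
inductive SwapLog (T₀ : Order V) : List ((V × V) × ℕ) → Order V → Prop
  | nil : SwapLog T₀ [] T₀
  | concat {L : List ((V × V) × ℕ)} {T : Order V} {u v : V} :
      SwapLog T₀ L T → T u < T v →
        SwapLog T₀ (L ++ [((u, v), dist T u v)]) ((Equiv.swap u v).trans T)

theorem sum_mul_swap_trans_sub (huv : T u < T v) (g : V → ℝ) :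
    ∑ w, g w * ((((Equiv.swap u v).trans T w : ℕ) : ℝ) - ((T w : ℕ) : ℝ)) =
      dist T u v * (g u - g v) := by
  have hne : u ≠ v := fun h => huv.ne (congrArg T h)
  rw [Fintype.sum_eq_add u v hne fun w hw => by
    simp [Equiv.swap_apply_of_ne_of_ne hw.1 hw.2], cast_dist_of_lt huv]
  simp only [Equiv.trans_apply, Equiv.swap_apply_left, Equiv.swap_apply_right]
  ring

theorem SwapLog.sum_dist_mul_sub (h : SwapLog T₀ L T) (g : V → ℝ) :
    (L.map fun e => (e.2 : ℝ) * (g e.1.1 - g e.1.2)).sum =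
      ∑ w, g w * (((T w : ℕ) : ℝ) - ((T₀ w : ℕ) : ℝ)) := by
  induction h with
  | nil => simp
  | concat _ huv ih =>
    rw [List.map_append, List.sum_append, ih, List.map_singleton, List.sum_singleton,
      ← sum_mul_swap_trans_sub huv, ← Finset.sum_add_distrib]
    exact Finset.sum_congr rfl fun w _ => by ring

/-- Every entry of the log is inverted in `T`. -/
def AllInverted (T : Order V) (L : List ((V × V) × ℕ)) : Prop :=
  ∀ e ∈ L, T e.1.2 < T e.1.1

theorem SwapLog.sum_dist_mul_dist_le (h : SwapLog T₀ L T) (hL : AllInverted T L) :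
    (L.map fun e => (e.2 : ℝ) * dist T e.1.2 e.1.1).sum ≤ (Fintype.card V : ℝ) ^ 3 := by
  calc (L.map fun e => (e.2 : ℝ) * dist T e.1.2 e.1.1).sum
      = (L.map fun e => (e.2 : ℝ) * (((T e.1.1 : ℕ) : ℝ) - ((T e.1.2 : ℕ) : ℝ))).sum := by
        congr 1
        exact List.map_congr_left fun e he => by rw [cast_dist_of_lt (hL e he)]
    _ = ∑ w, ((T w : ℕ) : ℝ) * (((T w : ℕ) : ℝ) - ((T₀ w : ℕ) : ℝ)) :=
        h.sum_dist_mul_sub fun w => ((T w : ℕ) : ℝ)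
    _ ≤ ∑ _w : V, (Fintype.card V : ℝ) * Fintype.card V := by
        refine Finset.sum_le_sum fun w _ => ?_
        calc ((T w : ℕ) : ℝ) * (((T w : ℕ) : ℝ) - ((T₀ w : ℕ) : ℝ))
            ≤ ((T w : ℕ) : ℝ) * ((T w : ℕ) : ℝ) := by
              gcongr
              exact sub_le_self _ (Nat.cast_nonneg _)
          _ ≤ (Fintype.card V : ℝ) * Fintype.card V := by
              gcongr <;> exact (T w).isLt.le
    _ = (Fintype.card V : ℝ) ^ 3 := by
        rw [Finset.sum_const, Finset.card_univ, nsmul_eq_mul]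
        ring

end Swaps

section TruncatedDistances

theorem D_cons {V : Type u} [DecidableEq V] (e : (V × V) × ℕ) (L : List ((V × V) × ℕ)) (u v : V) :
    D (e :: L) u v = if (u, v) = e.1 then e.2 else D L u v := by
  obtain ⟨q, d⟩ := e
  rcases eq_or_ne (u, v) q with rfl | h
  · simp [D]
  · simp [D, List.lookup_cons, beq_eq_false_iff_ne.2 h, h]

theorem exists_mem_of_D_ne_zero {V : Type u} [DecidableEq V] {L : List ((V × V) × ℕ)} {u v : V}
    (h : D L u v ≠ 0) : ∃ e ∈ L, e.1 = (u, v) := by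
  induction L with
  | nil => simp [D] at h
  | cons e L ih =>
    rw [D_cons] at h
    split_ifs at h with he
    · exact ⟨e, List.mem_cons_self, he.symm⟩
    · obtain ⟨e', he', heq⟩ := ih h
      exact ⟨e', List.mem_cons_of_mem e he', heq⟩

theorem Dk_le_D {V : Type u} [DecidableEq V] (L : List ((V × V) × ℕ)) (k : ℝ)
    (u v : V) : Dk L k u v ≤ D L u v := by
  unfold Dk
  split_ifs with h
  exacts [le_rfl, (not_le.1 h).le]

theorem Dk_le {V : Type u} [DecidableEq V] (L : List ((V × V) × ℕ)) (k : ℝ)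
    (u v : V) : Dk L k u v ≤ k := by
  unfold Dk
  split_ifs with h
  exacts [h, le_rfl]

variable {V : Type u} [Fintype V] [DecidableEq V] {T T₀ : Order V} {L : List ((V × V) × ℕ)}
  {k l : ℝ}

theorem sum_D_mul_le (L : List ((V × V) × ℕ)) {g : V → V → ℝ} (hg : ∀ u v, 0 ≤ g u v) :
    ∑ u, ∑ v, (D L u v : ℝ) * g u v ≤ (L.map fun e => (e.2 : ℝ) * g e.1.1 e.1.2).sum := by
  induction L with
  | nil => simp [D]
  | cons e L ih =>
    have D_mul_le (u v : V) : (D (e :: L) u v : ℝ) * g u v ≤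
        (if (u, v) = e.1 then (e.2 : ℝ) * g u v else 0) + D L u v * g u v := by
      have := mul_nonneg (Nat.cast_nonneg (α := ℝ) (D L u v)) (hg u v)
      rw [D_cons]
      split_ifs <;> simp [this]
    have sum_head : ∑ u, ∑ v, (if (u, v) = e.1 then (e.2 : ℝ) * g u v else 0) =
        e.2 * g e.1.1 e.1.2 := by
      rw [← Fintype.sum_prod_type' fun u v => if (u, v) = e.1 then (e.2 : ℝ) * g u v else 0]
      simp
    calc ∑ u, ∑ v, (D (e :: L) u v : ℝ) * g u v
        ≤ ∑ u, ∑ v, ((if (u, v) = e.1 then (e.2 : ℝ) * g u v else 0) + D L u v * g u v) := by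
          gcongr
          exact D_mul_le _ _
      _ = e.2 * g e.1.1 e.1.2 + ∑ u, ∑ v, (D L u v : ℝ) * g u v := by
          simp only [Finset.sum_add_distrib, sum_head]
      _ ≤ _ := by
          rw [List.map_cons, List.sum_cons]
          gcongr

theorem Dk_le_near_add_far (hL : AllInverted T L) (hl : 0 < l) (u v : V) :
    Dk L k u v ≤ (if T v < T u ∧ dist T v u ≤ ⌊l⌋₊ then k else 0) + D L u v * dist T v u / l := by
  split_ifs with hnear
  · have far_nonneg : (0 : ℝ) ≤ D L u v * dist T v u / l := by positivity
    exact (Dk_le L k u v).trans (le_add_of_nonneg_right far_nonneg)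
  rw [zero_add]
  refine (Dk_le_D L k u v).trans ?_
  by_cases hD : D L u v = 0
  · simp [hD]
  obtain ⟨e, he, heq⟩ := exists_mem_of_D_ne_zero hD
  have hvu : T v < T u := by simpa [heq] using hL e he
  have hfar : l ≤ dist T v u := (Nat.lt_of_floor_lt (not_le.1 fun h => hnear ⟨hvu, h⟩)).le
  rw [le_div_iff₀ hl]
  gcongr

theorem SwapLog.sum_Dk_le_add (h : SwapLog T₀ L T) (hL : AllInverted T L) (hk : 0 ≤ k)
    (hl : 0 < l) : ∑ u, ∑ v, Dk L k u v ≤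
      Fintype.card V * (l * k) + (Fintype.card V : ℝ) ^ 3 / l := by
  have near : ∑ u, ∑ v, (if T v < T u ∧ dist T v u ≤ ⌊l⌋₊ then k else 0) ≤
      Fintype.card V * (l * k) := by
    rw [← nsmul_eq_mul]
    refine Finset.sum_le_card_nsmul _ _ _ fun u _ => ?_
    rw [← Finset.sum_filter, Finset.sum_const, nsmul_eq_mul]
    gcongr
    exact (Nat.cast_le.2 (card_filter_lt_and_dist_le T u _)).trans (Nat.floor_le hl.le)
  have far : ∑ u, ∑ v, (D L u v : ℝ) * dist T v u / l ≤ (Fintype.card V : ℝ) ^ 3 / l := by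
    simp only [← Finset.sum_div]
    gcongr
    exact (sum_D_mul_le L fun u v => Nat.cast_nonneg (dist T v u)).trans
      (h.sum_dist_mul_dist_le hL)
  refine (Finset.sum_le_sum fun u _ => Finset.sum_le_sum fun v _ =>
    Dk_le_near_add_far hL hl u v).trans ?_
  simp only [Finset.sum_add_distrib]
  exact add_le_add near far

theorem SwapLog.sum_Dk_le (h : SwapLog T₀ L T) (hL : AllInverted T L) (hk : 0 ≤ k) :
    ∑ u, ∑ v, Dk L k u v ≤ 2 * (Fintype.card V : ℝ) ^ 2 * √k := by
  rcases isEmpty_or_nonempty V with _ | _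
  · simp
  rcases hk.eq_or_lt with rfl | hk
  · rw [Real.sqrt_zero, mul_zero]
    exact Finset.sum_nonpos fun u _ => Finset.sum_nonpos fun v _ => Dk_le L 0 u v
  have hn : 0 < (Fintype.card V : ℝ) := Nat.cast_pos.2 Fintype.card_pos
  have hs : 0 < √k := Real.sqrt_pos.2 hk
  -- This radius balances the two terms of the bound.
  refine (h.sum_Dk_le_add hL hk.le (div_pos hn hs)).trans_eq ?_
  field_simp
  rw [Real.sq_sqrt hk.le]
  ring

end TruncatedDistances

section Lists

variable {V : Type u} [Fintype V] {T : Order V} {S : Finset V} {w : V}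

theorem mem_increasing : w ∈ increasing T S ↔ w ∈ S := by
  simp [increasing]

theorem mem_decreasing : w ∈ decreasing T S ↔ w ∈ S := by
  simp [decreasing, mem_increasing]

theorem pairwise_increasing (T : Order V) (S : Finset V) :
    (increasing T S).Pairwise fun a b => T a < T b := by
  unfold increasing
  rw [List.pairwise_map]
  simpa only [Equiv.apply_symm_apply] using (Finset.sortedLT_sort (S.image T)).pairwise

theorem pairwise_decreasing (T : Order V) (S : Finset V) :
    (decreasing T S).Pairwise fun a b => T b < T a :=
  List.pairwise_reverse.2 (pairwise_increasing T S)

theorem exists_increasing_eq_cons (T : Order V) (hS : S.Nonempty) :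
    ∃ m ∈ S, (∀ w ∈ S, T m ≤ T w) ∧ ∃ l, increasing T S = m :: l := by
  obtain ⟨w, hw⟩ := hS
  obtain ⟨m, l, h⟩ := List.exists_cons_of_ne_nil (List.ne_nil_of_mem (mem_increasing (T := T).2 hw))
  have hmin := (List.pairwise_cons.1 (h ▸ pairwise_increasing T S)).1
  simp only [← mem_increasing (T := T) (S := S), h, List.forall_mem_cons]
  exact ⟨m, List.mem_cons_self, ⟨le_rfl, fun w hw => (hmin w hw).le⟩, l, rfl⟩

theorem exists_decreasing_eq_cons (T : Order V) (hS : S.Nonempty) :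
    ∃ m ∈ S, (∀ w ∈ S, T w ≤ T m) ∧ ∃ l, decreasing T S = m :: l := by
  obtain ⟨w, hw⟩ := hS
  obtain ⟨m, l, h⟩ := List.exists_cons_of_ne_nil (List.ne_nil_of_mem (mem_decreasing (T := T).2 hw))
  have hmax := (List.pairwise_cons.1 (h ▸ pairwise_decreasing T S)).1
  simp only [← mem_decreasing (T := T) (S := S), h, List.forall_mem_cons]
  exact ⟨m, List.mem_cons_self, ⟨le_rfl, fun w hw => (hmax w hw).le⟩, l, rfl⟩

end Lists

section Subcalls

variable {V : Type u} [Fintype V] [DecidableEq V] {T : Order V} {u v : V} {A B : Finset V}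

theorem mem_subcalls {r : Instr V} :
    r ∈ subcalls T u v A B ↔ ∃ u' ∈ insert u A, ∃ v' ∈ insert v B, T u' < T v' ∧
      Instr.reorder u' v' (decide (u' = u ∧ A = ∅)) (decide (v' = v ∧ B = ∅)) = r := by
  simp only [subcalls, List.mem_flatMap, List.mem_map, mem_decreasing, mem_increasing,
    Finset.mem_filter, and_assoc]

theorem exists_subcalls_eq_cons (huv : T u < T v) (hA : ∀ w ∈ A, T u < T w ∧ T w < T v)
    (hB : ∀ w ∈ B, T u < T w ∧ T w < T v) (hAB : ¬(A = ∅ ∧ B = ∅)) :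
    ∃ a b, T a < T b ∧ (T b : ℕ) - T a < (T v : ℕ) - T u ∧
      ∃ f₁ f₂ l, subcalls T u v A B = Instr.reorder a b f₁ f₂ :: l := by
  obtain ⟨a, ha, hmax, l, hl⟩ := exists_decreasing_eq_cons T (Finset.insert_nonempty u A)
  have hav : T a < T v := by
    rcases Finset.mem_insert.1 ha with rfl | ha
    exacts [huv, (hA a ha).2]
  obtain ⟨b, hb, hmin, l', hl'⟩ := exists_increasing_eq_cons T
    (S := (insert v B).filter fun w => T a < T w) ⟨v, by simp [hav]⟩
  have hua : T u ≤ T a := hmax u (Finset.mem_insert_self u A)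
  have hbv : T b ≤ T v := hmin v (by simp [hav])
  have hlt : T u < T a ∨ T b < T v := by
    rcases A.eq_empty_or_nonempty with rfl | ⟨w, hw⟩
    · obtain ⟨w, hw⟩ : B.Nonempty := Finset.nonempty_iff_ne_empty.2 fun h => hAB ⟨rfl, h⟩
      obtain rfl : a = u := by simpa using ha
      exact Or.inr ((hmin w (by simp [hw, hB w hw])).trans_lt (hB w hw).2)
    · exact Or.inl ((hA w hw).1.trans_le (hmax w (Finset.mem_insert_of_mem hw)))
  refine ⟨a, b, (Finset.mem_filter.1 hb).2, ?_, ?_⟩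
  · simp only [Fin.lt_def, Fin.le_def] at hav hua hbv hlt
    omega
  · simp only [subcalls, hl, List.flatMap_cons, hl', List.map_cons, List.cons_append]
    exact ⟨_, _, _, rfl⟩

end Subcalls

section Insertion

theorem EachPairSwappedAtMostOnce.concat {V : Type u} {L : List ((V × V) × ℕ)} {u v : V} {d : ℕ}
    (hL : EachPairSwappedAtMostOnce L) (huv : ∀ e ∈ L, e.1 ≠ (u, v))
    (hvu : ∀ e ∈ L, e.1 ≠ (v, u)) : EachPairSwappedAtMostOnce (L ++ [((u, v), d)]) := by
  unfold EachPairSwappedAtMostOnce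
  rw [List.map_append, List.map_singleton, ← List.concat_eq_append]
  refine List.Nodup.concat ?_ hL
  simp only [List.mem_map, not_exists, not_and, Sym2.eq_iff, not_or]
  exact fun e he => ⟨fun h₁ h₂ => huv e he (Prod.ext h₁ h₂), fun h₁ h₂ => hvu e he (Prod.ext h₁ h₂)⟩

theorem EachPairSwappedAtMostOnce.length_le {V : Type u} [Fintype V]
    {L : List ((V × V) × ℕ)} (hL : EachPairSwappedAtMostOnce L) :
    L.length ≤ Fintype.card (Sym2 V) := by
  simpa using List.Nodup.length_le_card hL

theorem Acyclic.mono {V : Type u} {E G : Finset (V × V)} (hG : Acyclic G) (h : E ⊆ G) :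
    Acyclic E :=
  fun x hx => hG x (TransGen.mono (fun _ _ hab => h hab) _ _ hx)

section Paths

variable {V : Type u} [DecidableEq V] {E : Finset (V × V)} {x y u v : V}

theorem transGen_insert (h : TransGen (Edge E) u v) : TransGen (Edge (insert (x, y) E)) u v :=
  TransGen.mono (fun _ _ => Finset.mem_insert_of_mem) _ _ h

theorem transGen_insert_of_reflTransGen (hux : ReflTransGen (Edge E) u x)
    (hyv : ReflTransGen (Edge E) y v) : TransGen (Edge (insert (x, y) E)) u v :=
  have mono {a b : V} : ReflTransGen (Edge E) a b → ReflTransGen (Edge (insert (x, y) E)) a b :=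
    ReflTransGen.mono (fun _ _ => Finset.mem_insert_of_mem) a b
  (TransGen.tail' (mono hux) (Finset.mem_insert_self (x, y) E)).trans_left (mono hyv)

theorem Acyclic.ne_of_reflTransGen (hG : Acyclic (insert (x, y) E))
    (hyu : ReflTransGen (Edge E) y u) (hvx : ReflTransGen (Edge E) v x) : u ≠ v := by
  rintro rfl
  exact hG u (transGen_insert_of_reflTransGen hvx hyu)

end Paths

variable {V : Type u} [Fintype V] {E : Finset (V × V)} {T T' : Order V} {x y u v : V}

/-- Passing from `T` to `T'`, no descendant of `y` moves down and no ancestor of `x` moves up, as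
is the case for every swap made while the edge `(x, y)` is being inserted. -/
structure MovesApart (E : Finset (V × V)) (x y : V) (T T' : Order V) : Prop where
  le_of_descendant : ∀ ⦃a⦄, ReflTransGen (Edge E) y a → T a ≤ T' a
  le_of_ancestor : ∀ ⦃a⦄, ReflTransGen (Edge E) a x → T' a ≤ T a

/-- The condition on a pending call while the edge `(x, y)` is being inserted: it is a call
`Reorder(u,v,f₁,f₂)` in which `u` descends from `y`, `v` is an ancestor of `x`, and the flags tell
the truth. -/
inductive ValidCall (E : Finset (V × V)) (T : Order V) (x y : V) : Instr V → Prop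
  | reorder {u v : V} {f₁ f₂ : Bool} (hyu : ReflTransGen (Edge E) y u)
      (hvx : ReflTransGen (Edge E) v x) (hf₁ : f₁ = true → NoOutBefore E T u v)
      (hf₂ : f₂ = true → NoInAfter E T u v) : ValidCall E T x y (Instr.reorder u v f₁ f₂)

/-- The condition on a pair `(u, v)` that has been swapped before or during the insertion of the
edge `(x, y)`: adding this edge leaves a path from `v` to `u`, and `v` already precedes `u`. -/
def Settled (E : Finset (V × V)) (T : Order V) (x y u v : V) : Prop :=
  TransGen (Edge E) v u ∨
    (T v < T u ∧ ReflTransGen (Edge E) v x ∧ ReflTransGen (Edge E) y u)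

theorem MovesApart.validCall (h : MovesApart E x y T T') {r : Instr V} (hr : ValidCall E T x y r) :
    ValidCall E T' x y r := by
  obtain ⟨hyu, hvx, hf₁, hf₂⟩ := hr
  refine .reorder hyu hvx (fun hf w hw => ?_) (fun hf w hw => ?_)
  · exact (h.le_of_ancestor hvx).trans ((hf₁ hf w hw).trans (h.le_of_descendant (hyu.tail hw)))
  · exact (h.le_of_ancestor (hvx.head hw)).trans ((hf₂ hf w hw).trans (h.le_of_descendant hyu))

theorem MovesApart.settled (h : MovesApart E x y T T') (hs : Settled E T x y u v) :
    Settled E T' x y u v :=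
  hs.imp_right fun ⟨hlt, hvx, hyu⟩ =>
    ⟨(h.le_of_ancestor hvx).trans_lt (hlt.trans_le (h.le_of_descendant hyu)), hvx, hyu⟩

theorem Settled.lt (hs : Settled E T x y u v) (hT : IsTopologicalOrder E T) : T v < T u :=
  hs.elim hT.lt_of_transGen And.left

theorem Settled.transGen [DecidableEq V] (hs : Settled E T x y u v) :
    TransGen (Edge (insert (x, y) E)) v u :=
  hs.elim transGen_insert fun ⟨_, hvx, hyu⟩ => transGen_insert_of_reflTransGen hvx hyu

theorem movesApart_swap [DecidableEq V] (hG : Acyclic (insert (x, y) E)) (huv : T u < T v)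
    (hyu : ReflTransGen (Edge E) y u) (hvx : ReflTransGen (Edge E) v x) :
    MovesApart E x y T ((Equiv.swap u v).trans T) where
  le_of_descendant _ ha := le_swap_trans_apply huv (hG.ne_of_reflTransGen ha hvx)
  le_of_ancestor _ ha := swap_trans_apply_le huv (hG.ne_of_reflTransGen hyu ha).symm

theorem ValidCall.of_mem_subcalls [DecidableEq V] {p : ℕ} {t : Fin (p + 2) → ℝ} {f₁ f₂ : Bool}
    {r : Instr V} (h : ValidCall E T x y (Instr.reorder u v f₁ f₂))
    (ht : (Fintype.card V : ℝ) ≤ t (Fin.last (p + 1))) (hT : IsTopologicalOrder E T)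
    (hr : r ∈ subcalls T u v (setA t E T u v f₁) (setB t E T u v f₂)) : ValidCall E T x y r := by
  obtain ⟨hyu, hvx, hf₁, hf₂⟩ := h
  obtain ⟨u', hu', v', hv', -, rfl⟩ := mem_subcalls.1 hr
  obtain ⟨hyu', huu'⟩ : ReflTransGen (Edge E) y u' ∧ T u ≤ T u' := by
    rcases Finset.mem_insert.1 hu' with rfl | hu'
    · exact ⟨hyu, le_rfl⟩
    · have huu' := (edge_and_lt_of_mem_setA hu').1
      exact ⟨hyu.tail huu', (hT u u' huu').le⟩
  obtain ⟨hv'x, hv'v⟩ : ReflTransGen (Edge E) v' x ∧ T v' ≤ T v := by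
    rcases Finset.mem_insert.1 hv' with rfl | hv'
    · exact ⟨hvx, le_rfl⟩
    · have hv'v := (edge_and_lt_of_mem_setB hv').1
      exact ⟨hvx.head hv'v, (hT v' v hv'v).le⟩
  refine .reorder hyu' hv'x (fun hf => ?_) fun hf => ?_
  · obtain ⟨rfl, hA⟩ := of_decide_eq_true hf
    exact fun w hw => hv'v.trans (noOutBefore_of_setA_eq_empty ht hT hf₁ hA w hw)
  · obtain ⟨rfl, hB⟩ := of_decide_eq_true hf
    exact fun w hw => (noInAfter_of_setB_eq_empty ht hT hf₂ hB w hw).trans huu'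

end Insertion

section Invariant

variable {V : Type u} [Fintype V] [DecidableEq V] {E : Finset (V × V)} {T₀ T : Order V}
  {L : List ((V × V) × ℕ)} {x y u v : V} {f₁ f₂ : Bool} {R : List (Instr V)} {p : ℕ}
  {t : Fin (p + 2) → ℝ} {s : State V}

/-- What holds at every moment of a run that starts with the order `T₀`, in terms of the current
graph, order and log. -/
structure Coherent (T₀ : Order V) (E : Finset (V × V)) (T : Order V) (L : List ((V × V) × ℕ)) :
    Prop where
  topological : IsTopologicalOrder E T
  swapLog : SwapLog T₀ L T
  swappedOnce : EachPairSwappedAtMostOnce L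

/-- What holds between two insertions. -/
structure Idle (T₀ : Order V) (E : Finset (V × V)) (T : Order V) (L : List ((V × V) × ℕ)) : Prop
    extends Coherent T₀ E T L where
  transGen : ∀ e ∈ L, TransGen (Edge E) e.1.2 e.1.1

/-- What holds during the insertion of the edge `(x, y)`, while the calls in `R` are pending. -/
structure Inserting (T₀ : Order V) (x y : V) (R : List (Instr V)) (E : Finset (V × V))
    (T : Order V) (L : List ((V × V) × ℕ)) : Prop extends Coherent T₀ E T L where
  validCall : ∀ r ∈ R, ValidCall E T x y r
  lt_or_mem : T x < T y ∨ ∃ f₁ f₂, Instr.reorder y x f₁ f₂ ∈ R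
  settled : ∀ e ∈ L, Settled E T x y e.1.1 e.1.2

theorem Idle.inserting (h : Idle T₀ E T L) (hR : ∀ r ∈ R, ValidCall E T x y r)
    (hxy : T x < T y ∨ ∃ f₁ f₂, Instr.reorder y x f₁ f₂ ∈ R) : Inserting T₀ x y R E T L :=
  { h with
    validCall := hR
    lt_or_mem := hxy
    settled := fun e he => Or.inl (h.transGen e he) }

theorem Inserting.idle_addEdge (h : Inserting T₀ x y [] E T L) :
    Idle T₀ (insert (x, y) E) T L where
  topological a b hab := by
    rcases Finset.mem_insert.1 hab with hab | hab
    · obtain ⟨rfl, rfl⟩ := Prod.mk.inj hab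
      simpa using h.lt_or_mem
    · exact h.topological a b hab
  swapLog := h.swapLog
  swappedOnce := h.swappedOnce
  transGen e he := (h.settled e he).transGen

theorem Inserting.lt_or_eq_or_mem (h : Inserting T₀ x y (Instr.reorder u v f₁ f₂ :: R) E T L) :
    T x < T y ∨ (y = u ∧ x = v) ∨ ∃ g₁ g₂, Instr.reorder y x g₁ g₂ ∈ R := by
  refine h.lt_or_mem.imp_right fun ⟨g₁, g₂, hmem⟩ => (List.mem_cons.1 hmem).imp (fun heq => ?_)
    fun hmem => ⟨g₁, g₂, hmem⟩
  obtain ⟨hyu, hxv, -, -⟩ := Instr.reorder.inj heq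
  exact ⟨hyu, hxv⟩

theorem Inserting.pop (h : Inserting T₀ x y (Instr.reorder u v f₁ f₂ :: R) E T L)
    (hG : Acyclic (insert (x, y) E)) (hvu : T v ≤ T u) : Inserting T₀ x y R E T L where
  toCoherent := h.toCoherent
  validCall r hr := h.validCall r (List.mem_cons_of_mem _ hr)
  lt_or_mem := by
    rcases h.lt_or_eq_or_mem with hlt | ⟨rfl, rfl⟩ | hmem
    · exact Or.inl hlt
    · exact Or.inl (hvu.lt_of_ne (T.injective.ne (hG.ne_of_reflTransGen .refl .refl).symm))
    · exact Or.inr hmem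
  settled := h.settled

theorem Inserting.swap (h : Inserting T₀ x y (Instr.reorder u v f₁ f₂ :: R) E T L)
    (hG : Acyclic (insert (x, y) E)) (huv : T u < T v) (hu : NoOutBefore E T u v)
    (hv : NoInAfter E T u v) :
    Inserting T₀ x y R E ((Equiv.swap u v).trans T) (L ++ [((u, v), dist T u v)]) := by
  obtain ⟨hyu, hvx, -, -⟩ := h.validCall _ List.mem_cons_self
  have hvu : TransGen (Edge (insert (x, y) E)) v u := transGen_insert_of_reflTransGen hvx hyu
  have hE : (u, v) ∉ E := fun huv => hG v (hvu.tail (Finset.mem_insert_of_mem huv))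
  have apart := movesApart_swap hG huv hyu hvx
  have swapped : (Equiv.swap u v).trans T v < (Equiv.swap u v).trans T u := by simpa using huv
  refine {
    topological := h.topological.swap_trans huv hE hu hv
    swapLog := h.swapLog.concat huv
    swappedOnce := h.swappedOnce.concat (fun e he heq => ?_) fun e he heq => ?_
    validCall := fun r hr => apart.validCall (h.validCall r (List.mem_cons_of_mem _ hr))
    lt_or_mem := ?_
    settled := fun e he => ?_ }
  · exact huv.not_gt (by simpa [heq] using (h.settled e he).lt h.topological)
  · exact hG u ((by simpa only [heq] using (h.settled e he).transGen : TransGen _ u v).trans hvu)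
  · rcases h.lt_or_eq_or_mem with hlt | ⟨rfl, rfl⟩ | hmem
    · exact Or.inl ((apart.le_of_ancestor .refl).trans_lt
        (hlt.trans_le (apart.le_of_descendant .refl)))
    · exact Or.inl swapped
    · exact Or.inr hmem
  · rcases List.mem_append.1 he with he | he
    · exact apart.settled (h.settled e he)
    · obtain rfl := List.mem_singleton.1 he
      exact Or.inr ⟨swapped, hvx, hyu⟩

theorem Inserting.expand (h : Inserting T₀ x y (Instr.reorder u v f₁ f₂ :: R) E T L)
    (ht : (Fintype.card V : ℝ) ≤ t (Fin.last (p + 1))) (huv : T u < T v) :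
    Inserting T₀ x y (subcalls T u v (setA t E T u v f₁) (setB t E T u v f₂) ++ R) E T L where
  toCoherent := h.toCoherent
  validCall r hr := by
    rcases List.mem_append.1 hr with hr | hr
    · exact (h.validCall _ List.mem_cons_self).of_mem_subcalls ht h.topological hr
    · exact h.validCall r (List.mem_cons_of_mem _ hr)
  lt_or_mem := by
    rcases h.lt_or_eq_or_mem with hlt | ⟨rfl, rfl⟩ | ⟨g₁, g₂, hmem⟩
    · exact Or.inl hlt
    · exact Or.inr ⟨_, _, List.mem_append_left R (mem_subcalls.2
        ⟨y, Finset.mem_insert_self _ _, x, Finset.mem_insert_self _ _, huv, rfl⟩)⟩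
    · exact Or.inr ⟨g₁, g₂, List.mem_append_right _ hmem⟩
  settled := h.settled

/-- What holds of every state of a run that starts with the order `T₀`: it is either between two
insertions or in the middle of one, and inserting all remaining edges keeps the graph acyclic. -/
inductive Invariant (T₀ : Order V) : State V → Prop
  | idle {E : Finset (V × V)} {T : Order V} {L : List ((V × V) × ℕ)} {es : List (V × V)}
      (hG : Acyclic (E ∪ es.toFinset)) (h : Idle T₀ E T L) :
      Invariant T₀ ⟨E, T, es.map fun e => Instr.insertEdge e.1 e.2, L⟩
  | inserting {x y : V} {R : List (Instr V)} {E : Finset (V × V)} {T : Order V}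
      {L : List ((V × V) × ℕ)} {es : List (V × V)}
      (hG : Acyclic (insert (x, y) E ∪ es.toFinset)) (h : Inserting T₀ x y R E T L) :
      Invariant T₀ ⟨E, T, R ++ Instr.addEdge x y :: es.map fun e => Instr.insertEdge e.1 e.2, L⟩

theorem Invariant.start {es : List (V × V)} (hT : IsTopologicalOrder E T₀)
    (hG : Acyclic (E ∪ es.toFinset)) : Invariant T₀ (start E T₀ es) :=
  .idle hG
    { topological := hT
      swapLog := .nil
      swappedOnce := List.nodup_nil
      transGen := by simp }

theorem Idle.invariant_step {es : List (V × V)} (h : Idle T₀ E T L)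
    (hG : Acyclic (E ∪ es.toFinset)) :
    Invariant T₀ (step t ⟨E, T, es.map fun e => Instr.insertEdge e.1 e.2, L⟩) := by
  rcases es with _ | ⟨⟨x, y⟩, es⟩
  · exact .idle hG h
  have hG' : Acyclic (insert (x, y) E ∪ es.toFinset) := by
    rwa [Finset.insert_union, ← Finset.union_insert, ← List.toFinset_cons]
  simp only [step, List.map_cons]
  split_ifs with hyx
  · refine .inserting (R := [Instr.reorder y x false false]) hG' (h.inserting ?_ ?_)
    · simpa using ValidCall.reorder .refl .refl (by simp) (by simp)
    · exact Or.inr ⟨false, false, List.mem_cons_self⟩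
  · exact .inserting (R := []) hG' (h.inserting (by simp) (Or.inl (not_le.1 hyx)))

theorem Inserting.invariant_step {es : List (V × V)} (h : Inserting T₀ x y R E T L)
    (ht : (Fintype.card V : ℝ) ≤ t (Fin.last (p + 1)))
    (hG : Acyclic (insert (x, y) E ∪ es.toFinset)) :
    Invariant T₀ (step t
      ⟨E, T, R ++ Instr.addEdge x y :: es.map fun e => Instr.insertEdge e.1 e.2, L⟩) := by
  rcases R with _ | ⟨r, R⟩
  · exact .idle hG h.idle_addEdge
  obtain ⟨-, -, hf₁, hf₂⟩ := h.validCall r List.mem_cons_self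
  have hG' : Acyclic (insert (x, y) E) := hG.mono Finset.subset_union_left
  simp only [step, List.cons_append]
  split_ifs with hvu hAB
  · exact .inserting hG (h.pop hG' hvu)
  · exact .inserting hG (h.swap hG' (not_le.1 hvu)
      (noOutBefore_of_setA_eq_empty ht h.topological hf₁ hAB.1)
      (noInAfter_of_setB_eq_empty ht h.topological hf₂ hAB.2))
  · rw [← List.append_assoc]
    exact .inserting hG (h.expand ht (not_le.1 hvu))

theorem Invariant.invariant_step (ht : (Fintype.card V : ℝ) ≤ t (Fin.last (p + 1)))
    (h : Invariant T₀ s) : Invariant T₀ (step t s) := by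
  rcases h with ⟨hG, h⟩ | ⟨hG, h⟩
  exacts [h.invariant_step hG, h.invariant_step ht hG]

theorem Invariant.coherent (h : Invariant T₀ s) : Coherent T₀ s.E s.T s.swaps := by
  rcases h with ⟨-, h⟩ | ⟨-, h⟩ <;> exact h.toCoherent

theorem Invariant.idle_of_todo_eq_nil (h : Invariant T₀ s) (hs : s.todo = []) :
    Idle T₀ s.E s.T s.swaps := by
  rcases h with ⟨-, h⟩ | -
  · exact h
  · simp at hs

theorem Idle.allInverted (h : Idle T₀ E T L) : AllInverted T L := fun e he =>
  h.topological.lt_of_transGen (h.transGen e he)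

end Invariant

section Termination

variable {V : Type u} [Fintype V] [DecidableEq V] {T₀ : Order V} {p : ℕ} {t : Fin (p + 2) → ℝ}
  {s : State V}

/-- A bound for the number of steps until the next swap or the end of the execution, in a state
with order `T` and the given control stack. A call `Reorder(u,v,·,·)` with `u < v` leads to a swap
before it returns, so the instructions below it do not matter. -/
def delay (T : Order V) : List (Instr V) → ℕ
  | [] => 0
  | Instr.insertEdge u v :: l => (T u : ℕ) - T v + delay T l + 3
  | Instr.addEdge _ _ :: l => delay T l + 1
  | Instr.reorder u v _ _ :: l => if T u < T v then (T v : ℕ) - T u else delay T l + 1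

theorem delay_subcalls_lt {E : Finset (V × V)} {T : Order V} {u v : V} {f₁ f₂ : Bool}
    (hT : IsTopologicalOrder E T) (huv : T u < T v)
    (hAB : ¬(setA t E T u v f₁ = ∅ ∧ setB t E T u v f₂ = ∅)) (l : List (Instr V)) :
    delay T (subcalls T u v (setA t E T u v f₁) (setB t E T u v f₂) ++ l) < (T v : ℕ) - T u := by
  obtain ⟨a, b, hab, hlt, g₁, g₂, l', hl'⟩ := exists_subcalls_eq_cons huv
    (fun w hw => ⟨hT u w (edge_and_lt_of_mem_setA hw).1, (edge_and_lt_of_mem_setA hw).2⟩)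
    (fun w hw => ⟨(edge_and_lt_of_mem_setB hw).2, hT w v (edge_and_lt_of_mem_setB hw).1⟩) hAB
  simpa only [hl', List.cons_append, delay, if_pos hab] using hlt

theorem step_swaps_or_delay_lt (hT : IsTopologicalOrder s.E s.T) (hs : s.todo ≠ []) :
    (step t s).swaps.length = s.swaps.length + 1 ∨
      (step t s).swaps = s.swaps ∧ delay (step t s).T (step t s).todo < delay s.T s.todo := by
  obtain ⟨E, T, _ | ⟨_ | _ | ⟨u, v, f₁, f₂⟩, l⟩, L⟩ := s
  · exact absurd rfl hs
  · simp only [step]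
    refine Or.inr ?_
    split_ifs <;> refine ⟨rfl, ?_⟩ <;> grind [delay]
  · exact Or.inr ⟨rfl, by simp [step, delay]⟩
  · simp only [step]
    split_ifs with hvu hAB
    · exact Or.inr ⟨rfl, by simp [delay, hvu.not_gt]⟩
    · exact Or.inl (by simp)
    · exact Or.inr ⟨rfl, by
        simpa only [delay, if_pos (not_le.1 hvu)] using delay_subcalls_lt hT (not_le.1 hvu) hAB l⟩

theorem Invariant.exists_halting (ht : (Fintype.card V : ℝ) ≤ t (Fin.last (p + 1)))
    (h : Invariant T₀ s) :
    ∃ N, Invariant T₀ ((step t)^[N] s) ∧ ((step t)^[N] s).todo = [] := by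
  induction hm : toLex (Fintype.card (Sym2 V) - s.swaps.length, delay s.T s.todo)
    using WellFoundedLT.induction generalizing s with
  | ind m ih =>
    by_cases hs : s.todo = []
    · exact ⟨0, h, hs⟩
    have hle := (h.invariant_step ht).coherent.swappedOnce.length_le
    have hlt : toLex (Fintype.card (Sym2 V) - (step t s).swaps.length,
        delay (step t s).T (step t s).todo) < m := by
      rw [← hm, Prod.Lex.toLex_lt_toLex]
      rcases step_swaps_or_delay_lt (t := t) h.coherent.topological hs with hswap | ⟨heq, hdelay⟩
      · exact Or.inl (by dsimp only; omega)
      · exact Or.inr ⟨by rw [heq], hdelay⟩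
    obtain ⟨N, hN⟩ := ih _ hlt (h.invariant_step ht) rfl
    exact ⟨N + 1, by simpa only [Function.iterate_succ_apply] using hN⟩

end Termination

end OnlineTopo

open OnlineTopo in
theorem mainTheorem4_general {V : Type*} [Fintype V] [DecidableEq V] {p : ℕ}
    {t : Fin (p + 2) → ℝ} (ht : (Fintype.card V : ℝ) ≤ t (Fin.last (p + 1)))
    {E₀ : Finset (V × V)} {T₀ : Order V} {es : List (V × V)} (hT : IsTopologicalOrder E₀ T₀)
    (hG : Acyclic (E₀ ∪ es.toFinset)) :
    ∃ s : State V, HaltsIn t (start E₀ T₀ es) s ∧ EachPairSwappedAtMostOnce s.swaps ∧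
      ∀ k : ℝ, 0 ≤ k → ∑ u, ∑ v, Dk s.swaps k u v ≤ 2 * (Fintype.card V : ℝ) ^ 2 * √k := by
  obtain ⟨N, hN, hnil⟩ := (Invariant.start hT hG).exists_halting ht
  have idle := hN.idle_of_todo_eq_nil hnil
  exact ⟨_, ⟨N, rfl, hnil⟩, idle.swappedOnce, fun k => idle.swapLog.sum_Dk_le idle.allInverted⟩

theorem mainTheorem4 :
    ∃ C : ℝ, 0 < C ∧
      ∀ (V : Type*) [Fintype V] [DecidableEq V]
        (p : ℕ) (t : Fin (p + 2) → ℝ),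
        √(Fintype.card V : ℝ) < t 0 → StrictMono t → t (Fin.last (p + 1)) = Fintype.card V →
      ∀ (E₀ : Finset (V × V)) (T₀ : OnlineTopo.Order V) (es : List (V × V)),
        OnlineTopo.IsTopologicalOrder E₀ T₀ →
        OnlineTopo.Acyclic (E₀ ∪ es.toFinset) →
        ∃ s : OnlineTopo.State V,
          OnlineTopo.HaltsIn t (OnlineTopo.start E₀ T₀ es) s ∧
          OnlineTopo.EachPairSwappedAtMostOnce s.swaps ∧
          ∀ k : ℝ, √(Fintype.card V : ℝ) ≤ k → k ≤ Fintype.card V →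
            ∑ u : V, ∑ v : V, OnlineTopo.Dk s.swaps k u v
              ≤ C * (Fintype.card V : ℝ) ^ 2 * √k := by
  refine ⟨2, two_pos, fun V _ _ p t _ _ ht E₀ T₀ es hT hG => ?_⟩
  obtain ⟨s, hs, hswaps, hsum⟩ := mainTheorem4_general ht.ge hT hG
  exact ⟨s, hs, hswaps, fun k hk _ => hsum k ((Real.sqrt_nonneg _).trans hk)⟩
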